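/- Let $N\in\mathbb N$, let $\Omega\subseteq\mathbb R^N$ be open (connected or not, of finite or infinite measure, with no condition on its boundary), and let $p>1$. Write $|\cdot|_\tau$ for the norm of $L^\tau(\Omega)$, $\|u\|_W=(|\nabla u|_p^p+|u|_p^p)^{1/p}$ for the norm of $W^{1,p}_0(\Omega)$ (the closure of $C_c^\infty(\Omega)$ in $W^{1,p}(\Omega)$), and let $X=W^{1,p}_0(\Omega)\cap L^\infty(\Omega)$ with $\|u\|_X=\|u\|_W+|u|_\infty$; $X'$ is the dual of $X$. A map $h:\Omega\times\mathbb R^m\to\mathbb R$ is called a $C^k$-Carathéodory function if $h(\cdot,y)$ is measurable for all $y\in\mathbb R^m$ and $h(x,\cdot)$ is $C^k$ for a.e. $x\in\Omega$. Let $A:\Omega\times\mathbb R\times\mathbb R^N\to\mathbb R$ and $g:\Omega\times\mathbb R\to\mathbb R$, and put $A_t=\partial A/\partial t$, $a=\nabla_\xi A$, $G(x,t)=\int_0^t g(x,\tau)\,d\tau$. Assume: - $(H_0)$ $A(x,t,\xi)$ is a $C^1$-Carathéodory function (in $y=(t,\xi)$); - $(H_1)$ there are positive continuous functions $\Phi_i,\phi_i:\mathbb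 R\to\mathbb R$, $i\in\{0,1,2\}$, such that for a.e. $x\in\Omega$ and all $(t,\xi)\in\mathbb R\times\mathbb R^N$ $$|A(x,t,\xi)|\le\Phi_0(t)|t|^p+\phi_0(t)|\xi|^p,\quad |A_t(x,t,\xi)|\le\Phi_1(t)|t|^{p-1}+\phi_1(t)|\xi|^p,\quad |a(x,t,\xi)|\le\Phi_2(t)|t|^{p-1}+\phi_2(t)|\xi|^{p-1};$$ - $(G_0)$ $g(x,t)$ is a $C^0$-Carathéodory function; - $(G_1)$ there are $a_1,a_2>0$ and $q\ge p$ such that $|g(x,t)|\le a_1|t|^{p-1}+a_2|t|^{q-1}$ for a.e. $x\in\Omega$ and all $t\in\mathbb R$. For $u,v\in X$ put $$J(u)=\int_\Omega A(x,u,\nabla u)\,dx-\int_\Omega G(x,u)\,dx,$$ $$\langle dJ(u),v\rangle=\int_\Omega a(x,u,\nabla u)\cdot\nabla v\,dx+\int_\Omega A_t(x,u,\nabla u)\,v\,dx-\int_\Omega g(x,u)\,v\,dx .$$ Then all these integrands are in $L^1(\Omega)$ and $dJ(u)\in X'$ for every $u\in X$. If $(u_n)_n\subset X$, $u\in X$ and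 $M>0$ are such that $\|u_n-u\|_W\to0$, $|u_n|_\infty\le M$ for all $n$, and $u_n\to u$ a.e. in $\Omega$, then $$J(u_n)\to J(u)\quad\text{and}\quad\|dJ(u_n)-dJ(u)\|_{X'}\to0 .$$ Hence $J$ is a $C^1$ functional on $X$, with Fréchet differential $dJ$. -/

import Mathlib

open MeasureTheory Filter Topology
open scoped ENNReal ContDiff

noncomputable section

/-- Euclidean space `ℝᴺ`. -/
abbrev Eucl (N : ℕ) : Type := EuclideanSpace ℝ (Fin N)

instance factOneLeOfReal (p : ℝ) [h : Fact (1 < p)] : Fact (1 ≤ ENNReal.ofReal p) :=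
  ⟨by simpa using ENNReal.ofReal_le_ofReal h.out.le⟩

/-- Test functions on `Ω`: smooth functions with compact support contained in `Ω`. -/
structure IsTestFunction {N : ℕ} (Ω : Set (Eucl N)) (φ : Eucl N → ℝ) : Prop where
  smooth : ContDiff ℝ ∞ φ
  compact : HasCompactSupport φ
  support : tsupport φ ⊆ Ω

/-- `w` is the weak gradient of `u` on `Ω`: `∫ u ∂ᵢφ = - ∫ wᵢ φ` for all test functions `φ`
and all `i`. -/
def IsWeakGradient {N : ℕ} (Ω : Set (Eucl N)) (u : Eucl N → ℝ) (w : Eucl N → Eucl N) : Prop :=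
  ∀ φ : Eucl N → ℝ, IsTestFunction Ω φ → ∀ i : Fin N,
    ∫ x in Ω, u x * fderiv ℝ φ x (EuclideanSpace.single i 1) = - ∫ x in Ω, w x i * φ x

/-- Pairs `(u, w)` of a function and a vector field in `Lᵖ(Ω)`, with the norm
`(|u|_p ^ p + |w|_p ^ p) ^ (1 / p)`. -/
abbrev LpPair {N : ℕ} (p : ℝ) (Ω : Set (Eucl N)) : Type :=
  WithLp (ENNReal.ofReal p)
    (Lp ℝ (ENNReal.ofReal p) (volume.restrict Ω) ×
      Lp (Eucl N) (ENNReal.ofReal p) (volume.restrict Ω))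

theorem integrable_mul_of_memLp {N : ℕ} (p : ℝ) [Fact (1 < p)] (Ω : Set (Eucl N))
    {F : Type*} [NormedAddCommGroup F] [NormedSpace ℝ F]
    (u : Lp F (ENNReal.ofReal p) (volume.restrict Ω)) {ψ : Eucl N → ℝ}
    (hψ : Continuous ψ) (hc : HasCompactSupport ψ) :
    Integrable (fun x => ψ x • u x) (volume.restrict Ω) := by
  have h : LocallyIntegrable u (volume.restrict Ω) :=
    (Lp.memLp u).locallyIntegrable (Fact.out : 1 ≤ ENNReal.ofReal p)
  exact h.integrable_smul_left_of_hasCompactSupport hψ hc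

theorem IsTestFunction.integrable_left {N : ℕ} {p : ℝ} [Fact (1 < p)] {Ω : Set (Eucl N)}
    {φ : Eucl N → ℝ} (hφ : IsTestFunction Ω φ)
    (u : Lp ℝ (ENNReal.ofReal p) (volume.restrict Ω)) (i : Fin N) :
    Integrable (fun x => u x * fderiv ℝ φ x (EuclideanSpace.single i 1))
      (volume.restrict Ω) := by
  have h := integrable_mul_of_memLp p Ω u
    (ψ := fun x => fderiv ℝ φ x (EuclideanSpace.single i 1))
    ((hφ.smooth.continuous_fderiv (by simp)).clm_apply continuous_const)
    (hφ.compact.fderiv_apply (𝕜 := ℝ) _)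
  simpa [mul_comm] using h

theorem IsTestFunction.integrable_right {N : ℕ} {p : ℝ} [Fact (1 < p)] {Ω : Set (Eucl N)}
    {φ : Eucl N → ℝ} (hφ : IsTestFunction Ω φ)
    (w : Lp (Eucl N) (ENNReal.ofReal p) (volume.restrict Ω)) (i : Fin N) :
    Integrable (fun x => w x i * φ x) (volume.restrict Ω) := by
  have h := integrable_mul_of_memLp p Ω w hφ.smooth.continuous hφ.compact
  have h2 := (EuclideanSpace.proj (𝕜 := ℝ) i : Eucl N →L[ℝ] ℝ).integrable_comp h
  simpa [mul_comm] using h2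

/-- The Sobolev space `W^{1,p}(Ω)`: a function in `Lᵖ(Ω)` together with its weak gradient,
which is also in `Lᵖ(Ω)`; the inherited norm is `(|∇u|_p ^ p + |u|_p ^ p) ^ (1 / p)`. -/
def sobolevW {N : ℕ} (p : ℝ) [Fact (1 < p)] (Ω : Set (Eucl N)) :
    Submodule ℝ (LpPair p Ω) where
  carrier := {z | IsWeakGradient Ω z.fst z.snd}
  zero_mem' := by
    intro φ hφ i
    have h1 : ∫ x in Ω, (0 : LpPair p Ω).fst x * fderiv ℝ φ x (EuclideanSpace.single i 1)
        = 0 := by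
      refine integral_eq_zero_of_ae ?_
      filter_upwards [Lp.coeFn_zero ℝ (ENNReal.ofReal p) (volume.restrict Ω)] with x hx
      have e : (0 : LpPair p Ω).fst x = 0 := hx
      rw [e]; simp
    have h2 : ∫ x in Ω, (0 : LpPair p Ω).snd x i * φ x = 0 := by
      refine integral_eq_zero_of_ae ?_
      filter_upwards [Lp.coeFn_zero (Eucl N) (ENNReal.ofReal p) (volume.restrict Ω)] with x hx
      have e : (0 : LpPair p Ω).snd x = 0 := hx
      rw [e]; simp
    rw [h1, h2, neg_zero]
  add_mem' := by
    intro y z hy hz φ hφ i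
    have h1 : ∫ x in Ω, (y + z).fst x * fderiv ℝ φ x (EuclideanSpace.single i 1)
        = (∫ x in Ω, y.fst x * fderiv ℝ φ x (EuclideanSpace.single i 1))
          + ∫ x in Ω, z.fst x * fderiv ℝ φ x (EuclideanSpace.single i 1) := by
      rw [← integral_add (hφ.integrable_left _ i) (hφ.integrable_left _ i)]
      refine integral_congr_ae ?_
      filter_upwards [Lp.coeFn_add y.fst z.fst] with x hx
      have e : (y + z).fst x = y.fst x + z.fst x := hx
      rw [e]; simp [add_mul]
    have h2 : ∫ x in Ω, (y + z).snd x i * φ x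
        = (∫ x in Ω, y.snd x i * φ x) + ∫ x in Ω, z.snd x i * φ x := by
      rw [← integral_add (hφ.integrable_right _ i) (hφ.integrable_right _ i)]
      refine integral_congr_ae ?_
      filter_upwards [Lp.coeFn_add y.snd z.snd] with x hx
      have e : (y + z).snd x = y.snd x + z.snd x := hx
      rw [e]; simp [add_mul]
    rw [h1, h2, hy φ hφ i, hz φ hφ i, neg_add]
  smul_mem' := by
    intro c z hz φ hφ i
    have h1 : ∫ x in Ω, (c • z).fst x * fderiv ℝ φ x (EuclideanSpace.single i 1)
        = c * ∫ x in Ω, z.fst x * fderiv ℝ φ x (EuclideanSpace.single i 1) := by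
      rw [← integral_const_mul]
      refine integral_congr_ae ?_
      filter_upwards [Lp.coeFn_smul c z.fst] with x hx
      simp [hx, mul_assoc]
    have h2 : ∫ x in Ω, (c • z).snd x i * φ x = c * ∫ x in Ω, z.snd x i * φ x := by
      rw [← integral_const_mul]
      refine integral_congr_ae ?_
      filter_upwards [Lp.coeFn_smul c z.snd] with x hx
      simp [hx, mul_assoc]
    rw [h1, h2, hz φ hφ i, mul_neg]

/-- The pairs `(φ, ∇φ)` with `φ` a test function on `Ω`. -/
def testPairs {N : ℕ} (p : ℝ) [Fact (1 < p)] (Ω : Set (Eucl N)) :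
    Submodule ℝ (LpPair p Ω) where
  carrier := {z | ∃ φ : Eucl N → ℝ, IsTestFunction Ω φ ∧
    z.fst =ᵐ[volume.restrict Ω] φ ∧ z.snd =ᵐ[volume.restrict Ω] gradient φ}
  zero_mem' := by
    refine ⟨0, ⟨contDiff_const, HasCompactSupport.zero, by simp [tsupport]⟩, ?_, ?_⟩
    · exact Lp.coeFn_zero ℝ (ENNReal.ofReal p) (volume.restrict Ω)
    · filter_upwards [Lp.coeFn_zero (Eucl N) (ENNReal.ofReal p) (volume.restrict Ω)] with x hx
      have e : (0 : LpPair p Ω).snd x = 0 := hx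
      rw [e]; simp [gradient]
  add_mem' := by
    rintro y z ⟨φ, hφ, h1, h2⟩ ⟨ψ, hψ, h3, h4⟩
    refine ⟨φ + ψ, ⟨hφ.smooth.add hψ.smooth, hφ.compact.add hψ.compact,
      (tsupport_add φ ψ).trans (Set.union_subset hφ.support hψ.support)⟩, ?_, ?_⟩
    · filter_upwards [h1, h3, Lp.coeFn_add y.fst z.fst] with x h1 h3 hx
      have e : (y + z).fst x = y.fst x + z.fst x := hx
      rw [e, h1, h3]; rfl
    · filter_upwards [h2, h4, Lp.coeFn_add y.snd z.snd] with x h2 h4 hx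
      have e1 := hφ.smooth.differentiable (by simp) x
      have e2 := hψ.smooth.differentiable (by simp) x
      have e : (y + z).snd x = y.snd x + z.snd x := hx
      rw [e, h2, h4]; simp [gradient, fderiv_add e1 e2]
  smul_mem' := by
    rintro c z ⟨φ, hφ, h1, h2⟩
    refine ⟨c • φ, ⟨hφ.smooth.const_smul c, hφ.compact.smul_left (f := fun _ => c),
      (tsupport_smul_subset_right (fun _ => c) φ).trans hφ.support⟩, ?_, ?_⟩
    · filter_upwards [h1, Lp.coeFn_smul c z.fst] with x h1 hx
      simp [hx, h1]
    · filter_upwards [h2, Lp.coeFn_smul c z.snd] with x h2 hx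
      have e1 := hφ.smooth.differentiable (by simp) x
      simp [hx, h2, gradient, fderiv_const_smul e1]

/-- `W₀^{1,p}(Ω)`: the closure of the test functions in `W^{1,p}(Ω)`. -/
def sobolevW0 {N : ℕ} (p : ℝ) [Fact (1 < p)] (Ω : Set (Eucl N)) :
    Submodule ℝ (LpPair p Ω) :=
  sobolevW p Ω ⊓ (testPairs p Ω).topologicalClosure

/-- `X = W₀^{1,p}(Ω) ∩ L^∞(Ω)`, as the space of elements `(u, ∇u)` of `W₀^{1,p}(Ω)` together with
`u` seen as an element of `L^∞(Ω)`. The inherited norm is `‖u‖_W + |u|_∞`. -/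
def sobolevXSubmodule {N : ℕ} (p : ℝ) [Fact (1 < p)] (Ω : Set (Eucl N)) :
    Submodule ℝ (WithLp 1 (LpPair p Ω × Lp ℝ ∞ (volume.restrict Ω))) where
  carrier := {z | z.fst ∈ sobolevW0 p Ω ∧ z.snd =ᵐ[volume.restrict Ω] z.fst.fst}
  zero_mem' := by
    refine ⟨(sobolevW0 p Ω).zero_mem, ?_⟩
    exact (Lp.coeFn_zero ℝ ∞ (volume.restrict Ω)).trans
      (Lp.coeFn_zero ℝ (ENNReal.ofReal p) (volume.restrict Ω)).symm
  add_mem' := by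
    rintro y z ⟨hy, hy'⟩ ⟨hz, hz'⟩
    refine ⟨(sobolevW0 p Ω).add_mem hy hz, ?_⟩
    filter_upwards [hy', hz', Lp.coeFn_add y.snd z.snd, Lp.coeFn_add y.fst.fst z.fst.fst]
      with x h1 h2 h3 h4
    have e1 : (y + z).snd x = y.snd x + z.snd x := h3
    have e2 : (y + z).fst.fst x = y.fst.fst x + z.fst.fst x := h4
    rw [e1, e2, h1, h2]
  smul_mem' := by
    rintro c z ⟨hz, hz'⟩
    refine ⟨(sobolevW0 p Ω).smul_mem c hz, ?_⟩
    filter_upwards [hz', Lp.coeFn_smul c z.snd, Lp.coeFn_smul c z.fst.fst] with x h1 h2 h3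
    simp [h1, h2, h3]

/-- The normed space `X = W₀^{1,p}(Ω) ∩ L^∞(Ω)`. -/
abbrev SobolevX {N : ℕ} (p : ℝ) [Fact (1 < p)] (Ω : Set (Eucl N)) : Type :=
  sobolevXSubmodule p Ω

namespace SobolevX

variable {N : ℕ} {p : ℝ} [Fact (1 < p)] {Ω : Set (Eucl N)}

/-- (A representative of) the function `u`. -/
def val (u : SobolevX p Ω) : Eucl N → ℝ := u.1.fst.fst

/-- (A representative of) the weak gradient `∇u`. -/
def grad (u : SobolevX p Ω) : Eucl N → Eucl N := u.1.fst.snd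

/-- `‖u‖_W = (|∇u|_p ^ p + |u|_p ^ p) ^ (1 / p)`. -/
def normW (u : SobolevX p Ω) : ℝ := ‖u.1.fst‖

/-- `|u|_∞`. -/
def normInfty (u : SobolevX p Ω) : ℝ := ‖u.1.snd‖

end SobolevX

/-- `h : Ω × F → ℝ` (curried) is a `C^k`-Carathéodory function: `h(·, y)` is Lebesgue measurable
on `Ω` for every `y`, and `h(x, ·)` is `C^k` for almost every `x ∈ Ω`. -/
def IsCaratheodory {N : ℕ} (k : ℕ) (Ω : Set (Eucl N)) {F : Type} [NormedAddCommGroup F]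
    [NormedSpace ℝ F] (h : Eucl N → F → ℝ) : Prop :=
  (∀ y, AEMeasurable (fun x => h x y) (volume.restrict Ω)) ∧
    ∀ᵐ x ∂volume.restrict Ω, ContDiff ℝ k (h x)

/-- The partial derivative `A_t(x, t, ξ)`. -/
def partialT {N : ℕ} (A : Eucl N → ℝ → Eucl N → ℝ) (x : Eucl N) (t : ℝ) (ξ : Eucl N) : ℝ :=
  deriv (fun s => A x s ξ) t

/-- The gradient `a(x, t, ξ)` of `A(x, t, ·)` at `ξ`. -/
def gradXi {N : ℕ} (A : Eucl N → ℝ → Eucl N → ℝ) (x : Eucl N) (t : ℝ) (ξ : Eucl N) : Eucl N :=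
  gradient (fun η => A x t η) ξ

/-- The primitive `G(x, t) = ∫₀ᵗ g(x, τ) dτ`. -/
def primitiveG {N : ℕ} (g : Eucl N → ℝ → ℝ) (x : Eucl N) (t : ℝ) : ℝ :=
  ∫ τ in (0 : ℝ)..t, g x τ

/-- The growth conditions on `A`, `A_t` and `a`. -/
def GrowthA {N : ℕ} (p : ℝ) (Ω : Set (Eucl N)) (A : Eucl N → ℝ → Eucl N → ℝ) : Prop :=
  ∃ Φ φ : Fin 3 → ℝ → ℝ,
    (∀ i, Continuous (Φ i) ∧ Continuous (φ i)) ∧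
    (∀ i t, 0 < Φ i t ∧ 0 < φ i t) ∧
    (∀ᵐ x ∂volume.restrict Ω, ∀ (t : ℝ) (ξ : Eucl N),
      |A x t ξ| ≤ Φ 0 t * |t| ^ p + φ 0 t * ‖ξ‖ ^ p) ∧
    (∀ᵐ x ∂volume.restrict Ω, ∀ (t : ℝ) (ξ : Eucl N),
      |partialT A x t ξ| ≤ Φ 1 t * |t| ^ (p - 1) + φ 1 t * ‖ξ‖ ^ p) ∧
    (∀ᵐ x ∂volume.restrict Ω, ∀ (t : ℝ) (ξ : Eucl N),
      ‖gradXi A x t ξ‖ ≤ Φ 2 t * |t| ^ (p - 1) + φ 2 t * ‖ξ‖ ^ (p - 1))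

/-- The growth condition on `g`. -/
def GrowthG {N : ℕ} (p : ℝ) (Ω : Set (Eucl N)) (g : Eucl N → ℝ → ℝ) : Prop :=
  ∃ a₁ a₂ q : ℝ, 0 < a₁ ∧ 0 < a₂ ∧ p ≤ q ∧
    ∀ᵐ x ∂volume.restrict Ω, ∀ t : ℝ, |g x t| ≤ a₁ * |t| ^ (p - 1) + a₂ * |t| ^ (q - 1)

/-- The functional `J(u) = ∫_Ω A(x, u, ∇u) dx - ∫_Ω G(x, u) dx` on `X`. -/
def energyJ {N : ℕ} {p : ℝ} [Fact (1 < p)] {Ω : Set (Eucl N)}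
    (A : Eucl N → ℝ → Eucl N → ℝ) (g : Eucl N → ℝ → ℝ) (u : SobolevX p Ω) : ℝ :=
  (∫ x in Ω, A x (u.val x) (u.grad x)) - ∫ x in Ω, primitiveG g x (u.val x)

/-- The expression
`⟨dJ(u), v⟩ = ∫_Ω a(x, u, ∇u) · ∇v dx + ∫_Ω A_t(x, u, ∇u) v dx - ∫_Ω g(x, u) v dx`. -/
def diffJ {N : ℕ} {p : ℝ} [Fact (1 < p)] {Ω : Set (Eucl N)}
    (A : Eucl N → ℝ → Eucl N → ℝ) (g : Eucl N → ℝ → ℝ) (u v : SobolevX p Ω) : ℝ :=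
  (∫ x in Ω, inner ℝ (gradXi A x (u.val x) (u.grad x)) (v.grad x))
    + (∫ x in Ω, partialT A x (u.val x) (u.grad x) * v.val x)
    - ∫ x in Ω, g x (u.val x) * v.val x

end

/-! The measure of `Ω` may be infinite, so bounded convergence is not available; the substitute is
Vitali's theorem with uniform integrability and tightness. If `u_n → u` in `W`, then `|u_n| +
|∇u_n|` converges in `Lᵖ`, so the family is uniformly integrable and tight. The bound `|u_n|_∞ ≤ M`
turns the `t`-dependent coefficients of the growth conditions into constants, so a superposition of
order `s` is dominated by `C (|u_n| + |∇u_n|) ^ s` and inherits both properties in `Lʳ` with `r s =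
p`. Since gradients converge a.e. along subsequences, the superposition converges in `Lʳ`
(`IsNemytskii.tendsto_eLpNorm`).

`A` has order `p` and converges in `L¹`; `a` has order `p - 1`, converges in the conjugate space of
`Lᵖ`, and is paired with `∇v`. The bound on `A_t` mixes both orders, and neither Lebesgue space
alone accommodates it: `|u| ^ (p - 1)` need not be in `L¹`, while `|∇u| ^ p` is only in `L¹`.
Truncation (`exists_partialT_split`) separates the two parts; one is paired with `v ∈ Lᵖ`, the other
with `v ∈ L^∞`. Hölder's inequality then gives convergence of the differentials in `X'`.

Differentiation under the integral gives the derivative along lines (`hasDerivAt_integral_line`).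
Convergence in `X` implies the convergence above, so the differential is continuous and the Gateaux
derivative is Fréchet. The term in `G` is the special case of an integrand independent of `ξ`, so
`exists_differential` is applied twice and the results subtracted. -/

noncomputable section

/-! ### Measurability of superpositions, and Vitali convergence under power domination. -/

/-- Superposition of a Carathéodory map with a measurable map is measurable. -/
theorem aestronglyMeasurable_superposition {α F H : Type*} [MeasurableSpace α] {μ : Measure α}
    [TopologicalSpace F] [TopologicalSpace.PseudoMetrizableSpace F]
    [TopologicalSpace H] [TopologicalSpace.PseudoMetrizableSpace H]
    {B : α → F → H} (hm : ∀ y, AEStronglyMeasurable (fun x => B x y) μ)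
    (hc : ∀ᵐ x ∂μ, Continuous (B x)) {u : α → F} (hu : AEStronglyMeasurable u μ) :
    AEStronglyMeasurable (fun x => B x (u x)) μ := by
  obtain ⟨v, hv, huv⟩ := hu
  have key : AEStronglyMeasurable (fun x => B x (v x)) μ := by
    refine aestronglyMeasurable_of_tendsto_ae atTop (f := fun n x => B x (hv.approx n x)) ?_ ?_
    · intro n
      set s := hv.approx n
      -- A simple function has finitely many level sets, and on each of them the superposition is `B
      -- x y` with `y` fixed.
      have hU : (⋃ y : s.range, s ⁻¹' {y.1}) = Set.univ := by
        ext x; simp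
      rw [← Measure.restrict_univ (μ := μ), ← hU, aestronglyMeasurable_iUnion_iff]
      intro y
      refine ((hm y).mono_measure Measure.restrict_le_self).congr ?_
      filter_upwards [ae_restrict_mem (s.measurableSet_preimage {y.1})] with x hx
      have : s x = y := hx
      simp [this]
    · filter_upwards [hc] with x hx
      exact (hx.tendsto _).comp (hv.tendsto_approx x)
  refine key.congr ?_
  filter_upwards [huv] with x hx
  rw [hx]

/-- Since `0 ^ s = 0`, the indicator commutes with the power. Small sets `S` transfer uniform
integrability from `z` to `f`; complements of sets of finite measure transfer tightness. -/
theorem eLpNorm_indicator_le_rpow {α H F : Type*} [MeasurableSpace α] {μ : Measure α}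
    [NormedAddCommGroup H] [NormedAddCommGroup F] {f : α → H} {z : α → F} {C s : ℝ}
    {p r : ℝ≥0∞} (hs : 0 < s) (hr : r * ENNReal.ofReal s = p)
    (h : ∀ᵐ x ∂μ, ‖f x‖ ≤ C * ‖z x‖ ^ s) (S : Set α) :
    eLpNorm (S.indicator f) r μ ≤ ENNReal.ofReal C * eLpNorm (S.indicator z) p μ ^ s := by
  rw [← hr, ← eLpNorm_norm_rpow _ hs]
  refine eLpNorm_le_mul_eLpNorm_of_ae_le_mul ?_ r
  filter_upwards [h] with x hx
  by_cases hxS : x ∈ S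
  · simpa [hxS, abs_of_nonneg (Real.rpow_nonneg (norm_nonneg (z x)) s)] using hx
  · simp [hxS, Real.zero_rpow hs.ne']

theorem memLp_of_le_mul_rpow {α H F : Type*} [MeasurableSpace α] {μ : Measure α}
    [NormedAddCommGroup H] [NormedAddCommGroup F] {f : α → H} {z : α → F} {C s : ℝ}
    {p r : ℝ≥0∞} (hs : 0 < s) (hr : r * ENNReal.ofReal s = p)
    (hf : AEStronglyMeasurable f μ) (hz : MemLp z p μ)
    (h : ∀ᵐ x ∂μ, ‖f x‖ ≤ C * ‖z x‖ ^ s) : MemLp f r μ := by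
  refine ⟨hf, ?_⟩
  have := eLpNorm_indicator_le_rpow hs hr h Set.univ
  simp only [Set.indicator_univ] at this
  exact this.trans_lt
    (ENNReal.mul_lt_top ENNReal.ofReal_lt_top (ENNReal.rpow_lt_top_of_nonneg hs.le hz.2.ne))

theorem exists_pos_mul_rpow_le (C : ℝ) {s ε : ℝ} (hs : 0 < s) (hε : 0 < ε) :
    ∃ η : ℝ, 0 < η ∧ ∀ y : ℝ≥0∞, y ≤ ENNReal.ofReal η →
      ENNReal.ofReal C * y ^ s ≤ ENNReal.ofReal ε := by
  have hC : 0 < |C| + 1 := by positivity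
  -- `η` solves `(|C| + 1) η ^ s = ε`; the `+ 1` covers `C = 0`.
  refine ⟨(ε / (|C| + 1)) ^ (1 / s), by positivity, fun y hy => ?_⟩
  calc ENNReal.ofReal C * y ^ s
      ≤ ENNReal.ofReal (|C| + 1) * ENNReal.ofReal ((ε / (|C| + 1)) ^ (1 / s)) ^ s := by
        gcongr
        linarith [le_abs_self C]
    _ = ENNReal.ofReal ε := by
        rw [ENNReal.ofReal_rpow_of_nonneg (by positivity) hs.le, ← Real.rpow_mul (by positivity),
          one_div_mul_cancel hs.ne', Real.rpow_one, ← ENNReal.ofReal_mul hC.le,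
          mul_div_cancel₀ _ hC.ne']

/-- Vitali convergence for a sequence dominated by a power of an `Lᵖ`-convergent sequence. -/
theorem tendsto_eLpNorm_of_le_mul_rpow {α H F : Type*} [MeasurableSpace α] {μ : Measure α}
    [NormedAddCommGroup H] [NormedAddCommGroup F] {f : ℕ → α → H} {g : α → H}
    {z : ℕ → α → F} {w : α → F} {C s : ℝ} {p r : ℝ≥0∞} (hp : 1 ≤ p) (hp' : p ≠ ⊤)
    (hs : 0 < s) (hr1 : 1 ≤ r) (hr' : r ≠ ⊤) (hr : r * ENNReal.ofReal s = p)
    (hf : ∀ n, AEStronglyMeasurable (f n) μ) (hg : MemLp g r μ)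
    (hz : ∀ n, MemLp (z n) p μ) (hw : MemLp w p μ)
    (hzw : Tendsto (fun n => eLpNorm (z n - w) p μ) atTop (𝓝 0))
    (h : ∀ n, ∀ᵐ x ∂μ, ‖f n x‖ ≤ C * ‖z n x‖ ^ s)
    (hfg : ∀ᵐ x ∂μ, Tendsto (fun n => f n x) atTop (𝓝 (g x))) :
    Tendsto (fun n => eLpNorm (f n - g) r μ) atTop (𝓝 0) := by
  -- The converse half of Vitali's theorem: `Lᵖ` convergence of `z` supplies the uniform
  -- integrability and tightness that `f` inherits.
  obtain ⟨-, hui, hut⟩ := (tendstoInMeasure_iff_tendsto_Lp hp hp' hz hw).2 hzw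
  refine tendsto_Lp_of_tendsto_ae hr1 hr' hf hg ?_ ?_ hfg
  · intro ε hε
    obtain ⟨η, hη, hle⟩ := exists_pos_mul_rpow_le C hs hε
    obtain ⟨δ, hδ, hδ'⟩ := hui hη
    exact ⟨δ, hδ, fun n S hS hSδ =>
      (eLpNorm_indicator_le_rpow hs hr (h n) S).trans (hle _ (hδ' n S hS hSδ))⟩
  · rw [unifTight_iff_real] at hut ⊢
    intro ε hε
    obtain ⟨η, hη, hle⟩ := exists_pos_mul_rpow_le C hs hε
    obtain ⟨S, hS, hS'⟩ := hut hη
    exact ⟨S, hS, fun n => (eLpNorm_indicator_le_rpow hs hr (h n) _).trans (hle _ (hS' n))⟩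

/-! ### Coordinates of the space `X` and its modes of convergence. -/

namespace SobolevX

variable {N : ℕ} {p : ℝ} [Fact (1 < p)] {Ω : Set (Eucl N)}

/-- `u ↦ u` as a continuous linear map `X → Lᵖ(Ω)`. -/
def valL : SobolevX p Ω →L[ℝ] Lp ℝ (ENNReal.ofReal p) (volume.restrict Ω) :=
  (WithLp.fstL _ ℝ _ _ ∘L WithLp.fstL _ ℝ _ _) ∘L (sobolevXSubmodule p Ω).subtypeL

/-- `u ↦ ∇u` as a continuous linear map `X → Lᵖ(Ω; ℝᴺ)`. -/
def gradL : SobolevX p Ω →L[ℝ] Lp (Eucl N) (ENNReal.ofReal p) (volume.restrict Ω) :=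
  (WithLp.sndL _ ℝ _ _ ∘L WithLp.fstL _ ℝ _ _) ∘L (sobolevXSubmodule p Ω).subtypeL

/-- `u ↦ u` as a continuous linear map `X → L^∞(Ω)`. -/
def inftyL : SobolevX p Ω →L[ℝ] Lp ℝ ⊤ (volume.restrict Ω) :=
  WithLp.sndL _ ℝ _ _ ∘L (sobolevXSubmodule p Ω).subtypeL

theorem coe_valL (u : SobolevX p Ω) : ⇑(valL u) = u.val := rfl

theorem coe_gradL (u : SobolevX p Ω) : ⇑(gradL u) = u.grad := rfl

theorem coe_inftyL (u : SobolevX p Ω) : inftyL u =ᵐ[volume.restrict Ω] u.val := u.2.2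

theorem memLp_val (u : SobolevX p Ω) : MemLp u.val (ENNReal.ofReal p) (volume.restrict Ω) :=
  Lp.memLp (valL u)

theorem memLp_grad (u : SobolevX p Ω) : MemLp u.grad (ENNReal.ofReal p) (volume.restrict Ω) :=
  Lp.memLp (gradL u)

theorem abs_val_le (u : SobolevX p Ω) : ∀ᵐ x ∂volume.restrict Ω, |u.val x| ≤ u.normInfty := by
  filter_upwards [coe_inftyL u, ae_le_eLpNormEssSup (f := ⇑(inftyL u)) (μ := volume.restrict Ω)]
    with x h1 h2
  rw [← h1]
  have h3 : u.normInfty = (eLpNormEssSup (inftyL u) (volume.restrict Ω)).toReal := by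
    rw [← eLpNorm_exponent_top]; rfl
  have h4 : eLpNormEssSup (inftyL u) (volume.restrict Ω) ≠ ⊤ := by
    rw [← eLpNorm_exponent_top]; exact (Lp.memLp (inftyL u)).2.ne
  rw [h3]
  simpa using ENNReal.toReal_mono h4 h2

theorem normInfty_le_norm (u : SobolevX p Ω) : u.normInfty ≤ ‖u‖ :=
  WithLp.norm_snd_le _ u.1

theorem normW_le_norm (u : SobolevX p Ω) : u.normW ≤ ‖u‖ :=
  WithLp.norm_fst_le _ u.1

theorem val_add_smul (u v : SobolevX p Ω) (s : ℝ) :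
    ∀ᵐ x ∂volume.restrict Ω, (u + s • v).val x = u.val x + s * v.val x := by
  have h : valL (u + s • v) = valL u + s • valL v := by simp
  filter_upwards [Lp.coeFn_add (valL u) (s • valL v), Lp.coeFn_smul s (valL v)] with x h1 h2
  rw [← coe_valL, h, h1, Pi.add_apply, h2]
  rfl

theorem grad_add_smul (u v : SobolevX p Ω) (s : ℝ) :
    ∀ᵐ x ∂volume.restrict Ω, (u + s • v).grad x = u.grad x + s • v.grad x := by
  have h : gradL (u + s • v) = gradL u + s • gradL v := by simp
  filter_upwards [Lp.coeFn_add (gradL u) (s • gradL v), Lp.coeFn_smul s (gradL v)] with x h1 h2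
  rw [← coe_gradL, h, h1, Pi.add_apply, h2]
  rfl

/-- The pointwise magnitude `|u| + |∇u|`. -/
def mag (u : SobolevX p Ω) (x : Eucl N) : ℝ := |u.val x| + ‖u.grad x‖

theorem mag_nonneg (u : SobolevX p Ω) (x : Eucl N) : 0 ≤ u.mag x := by
  unfold mag; positivity

theorem memLp_mag (u : SobolevX p Ω) : MemLp u.mag (ENNReal.ofReal p) (volume.restrict Ω) :=
  u.memLp_val.norm.add u.memLp_grad.norm

theorem tendsto_valL {un : ℕ → SobolevX p Ω} {u : SobolevX p Ω}
    (h : Tendsto (fun n => (un n - u).normW) atTop (𝓝 0)) :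
    Tendsto (fun n => valL (un n)) atTop (𝓝 (valL u)) := by
  rw [tendsto_iff_norm_sub_tendsto_zero]
  refine squeeze_zero (fun _ => norm_nonneg _) (fun n => ?_) h
  rw [← map_sub]
  exact WithLp.norm_fst_le _ (un n - u).1.fst

theorem tendsto_gradL {un : ℕ → SobolevX p Ω} {u : SobolevX p Ω}
    (h : Tendsto (fun n => (un n - u).normW) atTop (𝓝 0)) :
    Tendsto (fun n => gradL (un n)) atTop (𝓝 (gradL u)) := by
  rw [tendsto_iff_norm_sub_tendsto_zero]
  refine squeeze_zero (fun _ => norm_nonneg _) (fun n => ?_) h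
  rw [← map_sub]
  exact WithLp.norm_snd_le _ (un n - u).1.fst

theorem tendsto_mag {un : ℕ → SobolevX p Ω} {u : SobolevX p Ω}
    (h : Tendsto (fun n => (un n - u).normW) atTop (𝓝 0)) :
    Tendsto (fun n => eLpNorm ((un n).mag - u.mag) (ENNReal.ofReal p) (volume.restrict Ω))
      atTop (𝓝 0) := by
  have h1 := (Lp.tendsto_Lp_iff_tendsto_eLpNorm' _ _).1 (tendsto_valL h)
  have h2 := (Lp.tendsto_Lp_iff_tendsto_eLpNorm' _ _).1 (tendsto_gradL h)
  have h3 := h1.add h2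
  rw [add_zero] at h3
  refine tendsto_of_tendsto_of_tendsto_of_le_of_le tendsto_const_nhds h3 (fun _ => zero_le)
    fun n => ?_
  simp only [coe_valL, coe_gradL]
  have m1 := ((un n).memLp_val.sub u.memLp_val)
  have m2 := ((un n).memLp_grad.sub u.memLp_grad)
  rw [← eLpNorm_norm ((un n).val - u.val), ← eLpNorm_norm ((un n).grad - u.grad)]
  refine le_trans ?_ (eLpNorm_add_le m1.norm.1 m2.norm.1 Fact.out)
  refine eLpNorm_mono fun x => ?_
  simp only [mag, Pi.sub_apply, Pi.add_apply, Real.norm_eq_abs]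
  rw [abs_of_nonneg (a := |(un n).val x - u.val x| + ‖(un n).grad x - u.grad x‖) (by positivity)]
  calc |(|(un n).val x| + ‖(un n).grad x‖ - (|u.val x| + ‖u.grad x‖))|
      = |(|(un n).val x| - |u.val x|) + (‖(un n).grad x‖ - ‖u.grad x‖)| := by ring_nf
    _ ≤ _ := (abs_add_le _ _).trans
        (add_le_add (abs_abs_sub_abs_le_abs_sub _ _) (abs_norm_sub_norm_le _ _))

/-- The norm of `X` dominates the essential supremum, so outside a countable union of null sets the
convergence is uniform, and no subsequence is needed. -/
theorem tendsto_val_ae {un : ℕ → SobolevX p Ω} {u : SobolevX p Ω}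
    (h : Tendsto un atTop (𝓝 u)) :
    ∀ᵐ x ∂volume.restrict Ω, Tendsto (fun n => (un n).val x) atTop (𝓝 (u.val x)) := by
  rw [tendsto_iff_norm_sub_tendsto_zero] at h
  have h1 : ∀ᵐ x ∂volume.restrict Ω, ∀ n, |(un n).val x - u.val x| ≤ ‖un n - u‖ := by
    rw [ae_all_iff]
    intro n
    filter_upwards [abs_val_le (un n - u), val_add_smul (un n) u (-1)] with x hx hx'
    rw [neg_one_smul, ← sub_eq_add_neg] at hx'
    rw [hx'] at hx
    refine le_trans (le_of_eq ?_) (hx.trans (normInfty_le_norm _))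
    congr 1; ring
  filter_upwards [h1] with x hx
  rw [tendsto_iff_norm_sub_tendsto_zero]
  exact squeeze_zero (fun _ => norm_nonneg _) hx h

end SobolevX

/-! ### Nemytskii operators. -/

/-- Carathéodory maps `B(x, t, ξ)` of growth of order `s` in `(t, ξ)`, locally bounded
in `t`. -/
structure IsNemytskii {N : ℕ} {H : Type*} [NormedAddCommGroup H] (s : ℝ) (Ω : Set (Eucl N))
    (B : Eucl N → ℝ → Eucl N → H) : Prop where
  meas : ∀ t ξ, AEStronglyMeasurable (fun x => B x t ξ) (volume.restrict Ω)
  cont : ∀ᵐ x ∂volume.restrict Ω, Continuous (fun y : ℝ × Eucl N => B x y.1 y.2)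
  growth : ∃ K : ℝ → ℝ, Continuous K ∧
    ∀ᵐ x ∂volume.restrict Ω, ∀ t ξ, ‖B x t ξ‖ ≤ K t * (|t| + ‖ξ‖) ^ s

namespace IsNemytskii

variable {N : ℕ} {p : ℝ} [Fact (1 < p)] {Ω : Set (Eucl N)} {H : Type*} [NormedAddCommGroup H]
  {s : ℝ} {B : Eucl N → ℝ → Eucl N → H}

/-- The continuous coefficient is bounded on `[-M, M]`. This is where `L^∞` bounds enter. -/
theorem growth_on (h : IsNemytskii s Ω B) (M : ℝ) : ∃ C : ℝ, 0 ≤ C ∧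
    ∀ᵐ x ∂volume.restrict Ω, ∀ t ξ, |t| ≤ M → ‖B x t ξ‖ ≤ C * (|t| + ‖ξ‖) ^ s := by
  obtain ⟨K, hK, hB⟩ := h.growth
  obtain ⟨C, hC⟩ := (isCompact_Icc (a := -M) (b := M)).exists_bound_of_continuousOn
    hK.continuousOn
  refine ⟨|C|, abs_nonneg C, ?_⟩
  filter_upwards [hB] with x hx t ξ ht
  refine (hx t ξ).trans ?_
  have : K t ≤ |C| := (le_abs_self _).trans ((hC t (abs_le.1 ht)).trans (le_abs_self C))
  gcongr

theorem aestronglyMeasurable (h : IsNemytskii s Ω B) {f : Eucl N → ℝ} {w : Eucl N → Eucl N}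
    (hf : AEStronglyMeasurable f (volume.restrict Ω))
    (hw : AEStronglyMeasurable w (volume.restrict Ω)) :
    AEStronglyMeasurable (fun x => B x (f x) (w x)) (volume.restrict Ω) :=
  aestronglyMeasurable_superposition (B := fun x (y : ℝ × Eucl N) => B x y.1 y.2)
    (fun y => h.meas y.1 y.2) h.cont (hf.prodMk hw)

theorem memLp (h : IsNemytskii s Ω B) {r : ℝ≥0∞} (hs : 0 < s)
    (hr : r * ENNReal.ofReal s = ENNReal.ofReal p) (u : SobolevX p Ω) :
    MemLp (fun x => B x (u.val x) (u.grad x)) r (volume.restrict Ω) := by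
  obtain ⟨C, -, hC⟩ := h.growth_on u.normInfty
  refine memLp_of_le_mul_rpow hs hr (h.aestronglyMeasurable u.memLp_val.1 u.memLp_grad.1)
    u.memLp_mag (C := C) ?_
  filter_upwards [hC, u.abs_val_le] with x hx hu
  rw [Real.norm_of_nonneg (u.mag_nonneg x)]
  exact hx _ _ hu

theorem tendsto_eLpNorm (h : IsNemytskii s Ω B) {r : ℝ≥0∞} (hs : 0 < s) (hr1 : 1 ≤ r)
    (hr' : r ≠ ⊤) (hr : r * ENNReal.ofReal s = ENNReal.ofReal p)
    {un : ℕ → SobolevX p Ω} {u : SobolevX p Ω} {M : ℝ}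
    (hW : Tendsto (fun n => (un n - u).normW) atTop (𝓝 0))
    (hM : ∀ n, (un n).normInfty ≤ M)
    (hae : ∀ᵐ x ∂volume.restrict Ω, Tendsto (fun n => (un n).val x) atTop (𝓝 (u.val x))) :
    Tendsto (fun n => eLpNorm ((fun x => B x ((un n).val x) ((un n).grad x)) -
      fun x => B x (u.val x) (u.grad x)) r (volume.restrict Ω)) atTop (𝓝 0) := by
  obtain ⟨C, -, hC⟩ := h.growth_on M
  -- Convergence of `∇u_n` in `Lᵖ` gives a.e. convergence only along subsequences, which suffices
  -- because the limit does not depend on the subsequence.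
  refine tendsto_of_subseq_tendsto fun ns hns => ?_
  have hg := (Lp.tendsto_Lp_iff_tendsto_eLpNorm' _ _).1
    ((SobolevX.tendsto_gradL hW).comp hns)
  have hm : TendstoInMeasure (volume.restrict Ω) (fun n => (un (ns n)).grad) atTop u.grad :=
    tendstoInMeasure_of_tendsto_eLpNorm (p := ENNReal.ofReal p)
      (zero_lt_one.trans_le Fact.out).ne' (fun n => (un (ns n)).memLp_grad.1) u.memLp_grad.1 hg
  obtain ⟨ms, hms, hms'⟩ := hm.exists_seq_tendsto_ae
  have hsub : Tendsto (fun n => ns (ms n)) atTop atTop := hns.comp hms.tendsto_atTop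
  refine ⟨ms, tendsto_eLpNorm_of_le_mul_rpow (p := ENNReal.ofReal p) Fact.out
    ENNReal.ofReal_ne_top hs hr1 hr' hr (fun n => (h.memLp hs hr _).1) (h.memLp hs hr u)
    (fun n => (un (ns (ms n))).memLp_mag) u.memLp_mag
    ((SobolevX.tendsto_mag hW).comp hsub) (C := C) (fun n => ?_) ?_⟩
  · filter_upwards [hC, (un (ns (ms n))).abs_val_le] with x hx hu
    rw [Real.norm_of_nonneg (SobolevX.mag_nonneg _ x)]
    exact hx _ _ (hu.trans (hM _))
  · filter_upwards [h.cont, hae, hms'] with x hx h1 h2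
    exact (hx.tendsto (u.val x, u.grad x)).comp ((h1.comp hsub).prodMk_nhds h2)

end IsNemytskii

/-! ### Pointwise calculus of a `C¹` integrand. -/

section Calculus

variable {N : ℕ} {A : Eucl N → ℝ → Eucl N → ℝ} {x : Eucl N}

theorem partialT_eq_fderiv (h : ContDiff ℝ 1 (fun y : ℝ × Eucl N => A x y.1 y.2))
    (t : ℝ) (ξ : Eucl N) :
    partialT A x t ξ = fderiv ℝ (fun y : ℝ × Eucl N => A x y.1 y.2) (t, ξ) (1, 0) := by
  have h1 := (h.differentiable one_ne_zero (t, ξ)).hasFDerivAt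
  have h2 : HasDerivAt (fun s : ℝ => (s, ξ)) ((1 : ℝ), (0 : Eucl N)) t :=
    (hasDerivAt_id t).prodMk (hasDerivAt_const t ξ)
  exact (h1.comp_hasDerivAt t h2).deriv

theorem inner_gradXi_eq_fderiv (h : ContDiff ℝ 1 (fun y : ℝ × Eucl N => A x y.1 y.2))
    (t : ℝ) (ξ η : Eucl N) :
    inner ℝ (gradXi A x t ξ) η =
      fderiv ℝ (fun y : ℝ × Eucl N => A x y.1 y.2) (t, ξ) (0, η) := by
  have h1 := (h.differentiable one_ne_zero (t, ξ)).hasFDerivAt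
  have h2 : HasFDerivAt (fun ζ : Eucl N => (t, ζ)) (ContinuousLinearMap.inr ℝ ℝ (Eucl N)) ξ :=
    (hasFDerivAt_const t ξ).prodMk (hasFDerivAt_id ξ)
  have h3 : HasFDerivAt (fun ζ : Eucl N => A x t ζ) _ ξ := h1.comp ξ h2
  rw [gradXi, gradient, InnerProductSpace.toDual_symm_apply, h3.fderiv]
  rfl

/-- Coordinates reduce continuity and measurability of `a` to those of scalar directional
derivatives. -/
theorem gradXi_eq_sum (h : ContDiff ℝ 1 (fun y : ℝ × Eucl N => A x y.1 y.2))
    (t : ℝ) (ξ : Eucl N) :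
    gradXi A x t ξ = ∑ i : Fin N, fderiv ℝ (fun y : ℝ × Eucl N => A x y.1 y.2) (t, ξ)
      (0, EuclideanSpace.basisFun (Fin N) ℝ i) • EuclideanSpace.basisFun (Fin N) ℝ i := by
  rw [← (EuclideanSpace.basisFun (Fin N) ℝ).sum_repr' (gradXi A x t ξ)]
  refine Finset.sum_congr rfl fun i _ => ?_
  rw [real_inner_comm, inner_gradXi_eq_fderiv h]

theorem continuous_partialT (h : ContDiff ℝ 1 (fun y : ℝ × Eucl N => A x y.1 y.2)) :
    Continuous (fun y : ℝ × Eucl N => partialT A x y.1 y.2) := by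
  simp only [partialT_eq_fderiv h]
  exact (h.continuous_fderiv one_ne_zero).clm_apply continuous_const

theorem continuous_gradXi (h : ContDiff ℝ 1 (fun y : ℝ × Eucl N => A x y.1 y.2)) :
    Continuous (fun y : ℝ × Eucl N => gradXi A x y.1 y.2) := by
  simp only [gradXi_eq_sum h]
  exact continuous_finsetSum _ fun i _ =>
    ((h.continuous_fderiv one_ne_zero).clm_apply continuous_const).smul continuous_const

theorem hasDerivAt_along_line (h : ContDiff ℝ 1 (fun y : ℝ × Eucl N => A x y.1 y.2))
    (t τ : ℝ) (ξ η : Eucl N) (s : ℝ) :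
    HasDerivAt (fun s : ℝ => A x (t + s * τ) (ξ + s • η))
      (inner ℝ (gradXi A x (t + s * τ) (ξ + s • η)) η +
        partialT A x (t + s * τ) (ξ + s • η) * τ) s := by
  have h1 := (h.differentiable one_ne_zero (t + s * τ, ξ + s • η)).hasFDerivAt
  have h2 : HasDerivAt (fun s : ℝ => (t + s * τ, ξ + s • η)) (τ, η) s := by
    have e1 := ((hasDerivAt_id s).mul_const τ).const_add t
    have e2 := ((hasDerivAt_id s).smul_const η).const_add ξ
    simpa using e1.prodMk e2
  have h3 := h1.comp_hasDerivAt s h2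
  rw [inner_gradXi_eq_fderiv h, partialT_eq_fderiv h]
  have e : (τ, η) = ((0 : ℝ), η) + τ • ((1 : ℝ), (0 : Eucl N)) := by simp
  rw [e, map_add, map_smul, smul_eq_mul, mul_comm τ] at h3
  exact h3

end Calculus

/-! ### Measurability and growth of `A`, `a` and `A_t`. -/

section Caratheodory

variable {N : ℕ} {Ω : Set (Eucl N)} {A : Eucl N → ℝ → Eucl N → ℝ} {p : ℝ}

/-- A directional derivative is the a.e. limit of difference quotients with step `1 / (n + 1)`, each
measurable in `x`. -/
theorem IsCaratheodory.aestronglyMeasurable_fderiv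
    {F : Type} [NormedAddCommGroup F] [NormedSpace ℝ F] {h : Eucl N → F → ℝ}
    (hh : IsCaratheodory 1 Ω h) (y v : F) :
    AEStronglyMeasurable (fun x => fderiv ℝ (h x) y v) (volume.restrict Ω) := by
  refine aestronglyMeasurable_of_tendsto_ae atTop
    (f := fun (n : ℕ) x => ((n : ℝ) + 1) * (h x (y + ((n : ℝ) + 1)⁻¹ • v) - h x y)) ?_ ?_
  · exact fun n => ((hh.1 _).aestronglyMeasurable.sub (hh.1 _).aestronglyMeasurable).const_mul _
  · filter_upwards [hh.2] with x hx
    have h1 := (hx.differentiable one_ne_zero y).hasFDerivAt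
    have h2 : Tendsto (fun n : ℕ => ((n : ℝ) + 1)⁻¹) atTop (𝓝[≠] 0) := by
      refine tendsto_nhdsWithin_iff.2 ⟨?_, Eventually.of_forall fun n => ?_⟩
      · simpa using tendsto_one_div_add_atTop_nhds_zero_nat (𝕜 := ℝ)
      · have : (0 : ℝ) < ((n : ℝ) + 1)⁻¹ := by positivity
        exact this.ne'
    have h3 := (h1.hasLineDerivAt v).tendsto_slope_zero.comp h2
    simpa [Function.comp_def] using h3

theorem add_mul_rpow_le {b c t e s : ℝ} (hs : 0 ≤ s) (hb : 0 ≤ b) (hc : 0 ≤ c)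
    (ht : 0 ≤ t) (he : 0 ≤ e) : b * t ^ s + c * e ^ s ≤ (b + c) * (t + e) ^ s := by
  rw [add_mul]
  gcongr <;> linarith

theorem isNemytskii_of_growthA
    (hA : IsCaratheodory 1 Ω (fun x (y : ℝ × Eucl N) => A x y.1 y.2))
    (hp : 1 < p) (hG : GrowthA p Ω A) : IsNemytskii p Ω A := by
  obtain ⟨Φ, φ, hc, hpos, h0, -, -⟩ := hG
  refine ⟨fun t ξ => (hA.1 (t, ξ)).aestronglyMeasurable, ?_,
    ⟨fun t => Φ 0 t + φ 0 t, (hc 0).1.add (hc 0).2, ?_⟩⟩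
  · filter_upwards [hA.2] with x hx using hx.continuous
  · filter_upwards [h0] with x hx t ξ
    exact (hx t ξ).trans (add_mul_rpow_le (by linarith) (hpos 0 t).1.le (hpos 0 t).2.le
      (abs_nonneg t) (norm_nonneg ξ))

theorem isNemytskii_gradXi
    (hA : IsCaratheodory 1 Ω (fun x (y : ℝ × Eucl N) => A x y.1 y.2))
    (hp : 1 < p) (hG : GrowthA p Ω A) :
    IsNemytskii (p - 1) Ω (gradXi A) := by
  obtain ⟨Φ, φ, hc, hpos, -, -, h2⟩ := hG
  refine ⟨fun t ξ => ?_, ?_, ⟨fun t => Φ 2 t + φ 2 t, (hc 2).1.add (hc 2).2, ?_⟩⟩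
  · refine AEStronglyMeasurable.congr (f := fun x => ∑ i : Fin N,
      fderiv ℝ (fun y : ℝ × Eucl N => A x y.1 y.2) (t, ξ)
      (0, EuclideanSpace.basisFun (Fin N) ℝ i) • EuclideanSpace.basisFun (Fin N) ℝ i) ?_ ?_
    · exact Finset.aestronglyMeasurable_fun_sum _ fun i _ =>
        (hA.aestronglyMeasurable_fderiv _ _).smul_const _
    · filter_upwards [hA.2] with x hx using (gradXi_eq_sum hx t ξ).symm
  · filter_upwards [hA.2] with x hx using continuous_gradXi hx
  · filter_upwards [h2] with x hx t ξ
    exact (hx t ξ).trans (add_mul_rpow_le (by linarith) (hpos 2 t).1.le (hpos 2 t).2.le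
      (abs_nonneg t) (norm_nonneg ξ))

theorem abs_clamp_le {b c : ℝ} (hb : 0 ≤ b) : |max (-b) (min b c)| ≤ b := by
  rw [abs_le]
  exact ⟨le_max_left _ _, max_le (by linarith) (min_le_left _ _)⟩

theorem abs_sub_clamp_le {b c e : ℝ} (he : 0 ≤ e) (h : |c| ≤ b + e) :
    |c - max (-b) (min b c)| ≤ e := by
  rw [abs_le] at *
  rcases le_total b c with h1 | h1 <;> rcases le_total (-b) c with h2 | h2 <;>
    rcases le_total (-b) b with h3 | h3 <;> simp only [min_eq_left, min_eq_right, max_eq_left,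
      max_eq_right, h1, h2, h3] <;> constructor <;> linarith

/-- `A_t` is the sum of a term of order `p - 1` and a term of order `p`. -/
theorem exists_partialT_split
    (hA : IsCaratheodory 1 Ω (fun x (y : ℝ × Eucl N) => A x y.1 y.2))
    (hp : 1 < p) (hG : GrowthA p Ω A) :
    ∃ P Q : Eucl N → ℝ → Eucl N → ℝ, IsNemytskii (p - 1) Ω P ∧ IsNemytskii p Ω Q ∧
      ∀ x t ξ, partialT A x t ξ = P x t ξ + Q x t ξ := by
  obtain ⟨Φ, φ, hc, hpos, -, h1, -⟩ := hG
  have hs : 0 ≤ p - 1 := by linarith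
  -- `A_t` is clamped to `[-b, b]`, with `b` the first term of its growth bound. The clamped part
  -- has order `p - 1`, the excess is at most the second term, and clamping preserves continuity and
  -- measurability.
  set b : ℝ → ℝ := fun t => Φ 1 t * |t| ^ (p - 1) with hb
  have hb0 : ∀ t, 0 ≤ b t := fun t => mul_nonneg (hpos 1 t).1.le (by positivity)
  have hbc : Continuous b := (hc 1).1.mul (continuous_abs.rpow_const fun _ => Or.inr hs)
  have hm : ∀ t ξ, AEStronglyMeasurable (fun x => partialT A x t ξ) (volume.restrict Ω) := by
    intro t ξ
    refine (hA.aestronglyMeasurable_fderiv (t, ξ) (1, 0)).congr ?_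
    filter_upwards [hA.2] with x hx using (partialT_eq_fderiv hx t ξ).symm
  have hPm : ∀ t ξ, AEStronglyMeasurable
      (fun x => max (-b t) (min (b t) (partialT A x t ξ))) (volume.restrict Ω) := fun t ξ =>
    aestronglyMeasurable_const.sup (aestronglyMeasurable_const.inf (hm t ξ))
  have hPc : ∀ᵐ x ∂volume.restrict Ω, Continuous
      (fun y : ℝ × Eucl N => max (-b y.1) (min (b y.1) (partialT A x y.1 y.2))) := by
    filter_upwards [hA.2] with x hx
    exact (hbc.comp continuous_fst).neg.max
      ((hbc.comp continuous_fst).min (continuous_partialT hx))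
  refine ⟨fun x t ξ => max (-b t) (min (b t) (partialT A x t ξ)),
    fun x t ξ => partialT A x t ξ - max (-b t) (min (b t) (partialT A x t ξ)),
    ⟨hPm, hPc, ⟨Φ 1, (hc 1).1, ?_⟩⟩, ⟨fun t ξ => (hm t ξ).sub (hPm t ξ), ?_,
      ⟨φ 1, (hc 1).2, ?_⟩⟩, fun x t ξ => by ring⟩
  · refine Eventually.of_forall fun x t ξ => (abs_clamp_le (hb0 t)).trans ?_
    have := (hpos 1 t).1.le
    simp only [hb]
    gcongr
    exact le_add_of_nonneg_right (norm_nonneg ξ)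
  · filter_upwards [hA.2, hPc] with x hx hx' using (continuous_partialT hx).sub hx'
  · filter_upwards [h1] with x hx t ξ
    have h3 := (hpos 1 t).2.le
    refine (abs_sub_clamp_le (mul_nonneg h3 (by positivity)) (hx t ξ)).trans ?_
    gcongr
    exact le_add_of_nonneg_left (abs_nonneg t)

end Caratheodory

/-! ### Hölder pairings, and the passage from Gateaux to Fréchet derivatives. -/

section Pairing

variable {α E F G : Type*} [MeasurableSpace α] {μ : Measure α}
  [NormedAddCommGroup E] [NormedSpace ℝ E] [NormedAddCommGroup F] [NormedSpace ℝ F]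
  [NormedAddCommGroup G] [NormedSpace ℝ G]

theorem MeasureTheory.MemLp.integrable_bilin {p q : ℝ≥0∞} [ENNReal.HolderConjugate p q]
    (B : E →L[ℝ] F →L[ℝ] G) {f : α → E} {g : α → F} (hf : MemLp f p μ) (hg : MemLp g q μ) :
    Integrable (fun x => B (f x) (g x)) μ := by
  have h := L1.integrable_coeFn (B.holder 1 (hf.toLp f) (hg.toLp g))
  refine h.congr ?_
  filter_upwards [B.coeFn_holder (r := 1) (hf.toLp f) (hg.toLp g), hf.coeFn_toLp, hg.coeFn_toLp]
    with x h1 h2 h3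
  rw [h1, h2, h3]

theorem lpPairing_toLp {p q : ℝ≥0∞} [ENNReal.HolderConjugate p q] [Fact (1 ≤ p)] [Fact (1 ≤ q)]
    (B : E →L[ℝ] F →L[ℝ] ℝ) {f : α → E} (hf : MemLp f p μ) (g : Lp F q μ) {g' : α → F}
    (hg : g =ᵐ[μ] g') : B.lpPairing μ p q (hf.toLp f) g = ∫ x, B (f x) (g' x) ∂μ := by
  rw [ContinuousLinearMap.lpPairing_eq_integral]
  refine integral_congr_ae ?_
  filter_upwards [hf.coeFn_toLp, hg] with x hx hx'
  rw [hx, hx']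

theorem Filter.Tendsto.clm_comp_right (L : E →L[ℝ] F →L[ℝ] ℝ) (T : G →L[ℝ] F) {a : ℕ → E}
    {b : E} (h : Tendsto a atTop (𝓝 b)) :
    Tendsto (fun n => (L (a n)).comp T) atTop (𝓝 ((L b).comp T)) :=
  ((L.continuous.clm_comp_const T).tendsto b).comp h

theorem Filter.Tendsto.strongDual_sub {a b : ℕ → StrongDual ℝ E} {a₀ b₀ : StrongDual ℝ E}
    (ha : Tendsto a atTop (𝓝 a₀)) (hb : Tendsto b atTop (𝓝 b₀)) :
    Tendsto (fun n => a n - b n) atTop (𝓝 (a₀ - b₀)) :=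
  ha.sub hb

theorem Filter.Tendsto.norm_strongDual_sub {a : ℕ → StrongDual ℝ E} {a₀ : StrongDual ℝ E}
    (ha : Tendsto a atTop (𝓝 a₀)) : Tendsto (fun n => ‖a n - a₀‖) atTop (𝓝 0) :=
  tendsto_iff_norm_sub_tendsto_zero.1 ha

theorem contDiff_one_of_hasFDerivAt {f : E → ℝ} {f' : E → StrongDual ℝ E}
    (hc : Continuous f') (hf : ∀ u, HasFDerivAt f (f' u) u) : ContDiff ℝ 1 f :=
  contDiff_one_iff_hasFDerivAt.2 ⟨f', hc, hf⟩

/-- A Gateaux differentiable function with continuous derivative is Fréchet differentiable. -/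
theorem hasFDerivAt_of_hasDerivAt_line {f : E → ℝ} {f' : E → StrongDual ℝ E}
    (hf : ∀ u v : E, HasDerivAt (fun s : ℝ => f (u + s • v)) (f' u v) 0)
    (hc : Continuous f') (u : E) : HasFDerivAt f (f' u) u := by
  -- Moving the base point to `u + s • v` turns differentiability at `0` into differentiability at
  -- every `s`.
  have hline : ∀ (v : E) (s : ℝ),
      HasDerivAt (fun s : ℝ => f (u + s • v)) (f' (u + s • v) v) s := by
    intro v s
    have h2 := hf (u + s • v) v
    rw [← sub_self s] at h2
    have h3 := h2.comp_sub_const s s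
    refine h3.congr_of_eventuallyEq (Eventually.of_forall fun τ => ?_)
    simp only [sub_smul]
    congr 1
    abel
  rw [hasFDerivAt_iff_isLittleO_nhds_zero, Asymptotics.isLittleO_iff]
  intro ε hε
  obtain ⟨δ, hδ, hδ'⟩ := Metric.continuousAt_iff.1 hc.continuousAt ε hε
  filter_upwards [Metric.ball_mem_nhds (0 : E) hδ] with v hv
  rw [mem_ball_zero_iff] at hv
  -- Mean value inequality for `f (u + s • v)` minus its linear part on `[0, 1]`; by continuity of
  -- `f'` the derivative of this difference is at most `ε * ‖v‖`.
  have key := norm_image_sub_le_of_norm_deriv_le_segment_01'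
    (f := fun s : ℝ => f (u + s • v) - s * f' u v)
    (f' := fun s : ℝ => f' (u + s • v) v - f' u v) (C := ε * ‖v‖) (fun s _ => ?_) (fun s hs => ?_)
  · simp only [one_smul, one_mul, zero_smul, zero_mul, add_zero, sub_zero] at key
    convert! key using 2
    ring
  · have := (hline v s).sub ((hasDerivAt_id s).mul_const (f' u v))
    simp only [one_mul] at this
    exact this.hasDerivWithinAt
  · rw [← sub_apply]
    refine (ContinuousLinearMap.le_opNorm _ _).trans ?_
    gcongr
    rw [← dist_eq_norm]
    refine (hδ' ?_).le
    rw [dist_eq_norm, add_sub_cancel_left, norm_smul, Real.norm_of_nonneg hs.1]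
    exact (mul_le_of_le_one_left (norm_nonneg v) hs.2.le).trans_lt hv

end Pairing

/-! ### Differentiability of the integral functional. -/

section Functional

variable {N : ℕ} {p : ℝ} [hp : Fact (1 < p)] {Ω : Set (Eucl N)}

/-- The Nemytskii operator `u ↦ B(x, u, ∇u)` from `X` to `Lʳ(Ω)`. -/
def IsNemytskii.toLp {H : Type*} [NormedAddCommGroup H] {s : ℝ} {B : Eucl N → ℝ → Eucl N → H}
    (h : IsNemytskii s Ω B) {r : ℝ≥0∞} (hs : 0 < s)
    (hr : r * ENNReal.ofReal s = ENNReal.ofReal p) (u : SobolevX p Ω) :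
    Lp H r (volume.restrict Ω) :=
  (h.memLp hs hr u).toLp _

theorem IsNemytskii.tendsto_toLp {H : Type*} [NormedAddCommGroup H] {s : ℝ}
    {B : Eucl N → ℝ → Eucl N → H} (h : IsNemytskii s Ω B) {r : ℝ≥0∞} [hr1 : Fact (1 ≤ r)]
    (hs : 0 < s) (hr' : r ≠ ⊤) (hr : r * ENNReal.ofReal s = ENNReal.ofReal p)
    {un : ℕ → SobolevX p Ω} {u : SobolevX p Ω} {M : ℝ}
    (hW : Tendsto (fun n => (un n - u).normW) atTop (𝓝 0))
    (hM : ∀ n, (un n).normInfty ≤ M)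
    (hae : ∀ᵐ x ∂volume.restrict Ω, Tendsto (fun n => (un n).val x) atTop (𝓝 (u.val x))) :
    Tendsto (fun n => h.toLp hs hr (un n)) atTop (𝓝 (h.toLp hs hr u)) :=
  (Lp.tendsto_Lp_iff_tendsto_eLpNorm'' _ _ _ _).2
    (h.tendsto_eLpNorm hs hr1.out hr' hr hW hM hae)

/-- Continuity of an `X`-continuous map follows from sequential continuity along sequences that
converge in `W`, are bounded in `L^∞` and converge almost everywhere. -/
theorem SobolevX.continuous_of_seq {T : Type*} [TopologicalSpace T] {f : SobolevX p Ω → T}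
    (h : ∀ (un : ℕ → SobolevX p Ω) (u : SobolevX p Ω) (M : ℝ),
      Tendsto (fun n => (un n - u).normW) atTop (𝓝 0) → (∀ n, (un n).normInfty ≤ M) →
      (∀ᵐ x ∂volume.restrict Ω, Tendsto (fun n => (un n).val x) atTop (𝓝 (u.val x))) →
      Tendsto (fun n => f (un n)) atTop (𝓝 (f u))) : Continuous f := by
  rw [continuous_iff_seqContinuous]
  intro un u hu
  obtain ⟨M, hM⟩ := (hu.norm.bddAbove_range)
  refine h un u M ?_ (fun n => (normInfty_le_norm _).trans (hM ⟨n, rfl⟩)) (tendsto_val_ae hu)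
  exact squeeze_zero (fun _ => norm_nonneg _) (fun n => normW_le_norm _)
    (tendsto_iff_norm_sub_tendsto_zero.1 hu)

variable {A : Eucl N → ℝ → Eucl N → ℝ}

/-- For `|s| < 1` the `s`-derivative of the integrand is dominated by a multiple of `Z ^ p`, where
`Z` is the sum of the magnitudes of `u` and `v`. In the terms of order `p - 1` the factor `∇v` or
`v` is bounded by `Z`; in the term of order `p`, `v` is bounded by its `L^∞` norm. -/
theorem hasDerivAt_integral_line (hA : IsCaratheodory 1 Ω (fun x (y : ℝ × Eucl N) => A x y.1 y.2))
    (hG : GrowthA p Ω A) (u v : SobolevX p Ω) :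
    HasDerivAt (fun s : ℝ => ∫ x in Ω, A x ((u + s • v).val x) ((u + s • v).grad x))
      (∫ x in Ω, (inner ℝ (gradXi A x (u.val x) (u.grad x)) (v.grad x) +
        partialT A x (u.val x) (u.grad x) * v.val x)) 0 := by
  have hp1 : 1 < p := hp.out
  have hNA := isNemytskii_of_growthA hA hp1 hG
  have hNa := isNemytskii_gradXi hA hp1 hG
  obtain ⟨P, Q, hP, hQ, hPQ⟩ := exists_partialT_split hA hp1 hG
  set M := u.normInfty + v.normInfty
  obtain ⟨C₁, hC₁, h1⟩ := hNa.growth_on M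
  obtain ⟨C₂, hC₂, h2⟩ := hP.growth_on M
  obtain ⟨C₃, hC₃, h3⟩ := hQ.growth_on M
  have hmt : AEStronglyMeasurable (fun x => partialT A x (u.val x) (u.grad x))
      (volume.restrict Ω) := by
    simp only [hPQ]
    exact (hP.aestronglyMeasurable u.memLp_val.1 u.memLp_grad.1).add
      (hQ.aestronglyMeasurable u.memLp_val.1 u.memLp_grad.1)
  have hcongr : (fun s : ℝ => ∫ x in Ω, A x ((u + s • v).val x) ((u + s • v).grad x)) =
      fun s : ℝ => ∫ x in Ω, A x (u.val x + s * v.val x) (u.grad x + s • v.grad x) := by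
    funext s
    refine integral_congr_ae ?_
    filter_upwards [SobolevX.val_add_smul u v s, SobolevX.grad_add_smul u v s] with x e1 e2
    rw [e1, e2]
  rw [hcongr]
  have hZ : Integrable (fun x => (u.mag x + v.mag x) ^ p) (volume.restrict Ω) := by
    have := (u.memLp_mag.add v.memLp_mag).integrable_norm_rpow
      (zero_lt_one.trans_le Fact.out).ne' ENNReal.ofReal_ne_top
    rw [ENNReal.toReal_ofReal (by linarith)] at this
    refine this.congr (Eventually.of_forall fun x => ?_)
    simp only [Pi.add_apply]
    rw [Real.norm_of_nonneg (add_nonneg (u.mag_nonneg x) (v.mag_nonneg x))]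
  have hres := hasDerivAt_integral_of_dominated_loc_of_deriv_le (μ := volume.restrict Ω)
    (F := fun s x => A x (u.val x + s * v.val x) (u.grad x + s • v.grad x))
    (F' := fun s x => inner ℝ (gradXi A x (u.val x + s * v.val x) (u.grad x + s • v.grad x))
      (v.grad x) + partialT A x (u.val x + s * v.val x) (u.grad x + s • v.grad x) * v.val x)
    (x₀ := 0) (s := Metric.ball 0 1)
    (bound := fun x => (C₁ + C₂ + C₃ * v.normInfty) * (u.mag x + v.mag x) ^ p)
    (Metric.ball_mem_nhds 0 one_pos) ?_ ?_ ?_ ?_ (hZ.const_mul _) ?_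
  · simpa using hres.2
  · refine Eventually.of_forall fun s => hNA.aestronglyMeasurable
      (u.memLp_val.1.add (v.memLp_val.1.const_mul s)) (u.memLp_grad.1.add
        (v.memLp_grad.1.const_smul s))
  · simpa using memLp_one_iff_integrable.1 (hNA.memLp (by linarith) (one_mul _) u)
  · simp only [zero_mul, zero_smul, add_zero]
    exact ((hNa.aestronglyMeasurable u.memLp_val.1 u.memLp_grad.1).inner
      v.memLp_grad.1).add (hmt.mul v.memLp_val.1)
  · filter_upwards [h1, h2, h3, u.abs_val_le, v.abs_val_le] with x h1 h2 h3 hu hv s hs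
    rw [mem_ball_zero_iff, Real.norm_eq_abs] at hs
    set t := u.val x + s * v.val x
    set ξ := u.grad x + s • v.grad x
    have hsv : |s * v.val x| ≤ |v.val x| := by
      rw [abs_mul]; exact mul_le_of_le_one_left (abs_nonneg _) hs.le
    have hsg : ‖s • v.grad x‖ ≤ ‖v.grad x‖ := by
      rw [norm_smul]; exact mul_le_of_le_one_left (norm_nonneg _) hs.le
    have ht : |t| ≤ |u.val x| + |v.val x| := (abs_add_le _ _).trans (by gcongr)
    have hξ : ‖ξ‖ ≤ ‖u.grad x‖ + ‖v.grad x‖ := (norm_add_le _ _).trans (by gcongr)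
    have htM : |t| ≤ M := ht.trans (add_le_add hu hv)
    set Z := u.mag x + v.mag x with hZdef
    have hZ0 : 0 ≤ Z := add_nonneg (u.mag_nonneg x) (v.mag_nonneg x)
    have htξ : |t| + ‖ξ‖ ≤ Z := by
      simp only [hZdef, SobolevX.mag]; linarith
    have hvZ : |v.val x| ≤ Z := by
      have := u.mag_nonneg x
      have := norm_nonneg (v.grad x)
      simp only [hZdef, SobolevX.mag] at *; linarith
    have hgZ : ‖v.grad x‖ ≤ Z := by
      have := u.mag_nonneg x
      have := abs_nonneg (v.val x)
      simp only [hZdef, SobolevX.mag] at *; linarith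
    -- `Z` may vanish, so the exponents are added using that their sum `p` is nonzero.
    have hpow : Z ^ (p - 1) * Z = Z ^ p := by
      conv_lhs => rw [← Real.rpow_one Z, ← Real.rpow_mul hZ0, one_mul]
      rw [← Real.rpow_add' hZ0 (by linarith), sub_add_cancel]
    have b1 : ‖gradXi A x t ξ‖ ≤ C₁ * Z ^ (p - 1) := (h1 t ξ htM).trans (by gcongr)
    have b2 : |P x t ξ| ≤ C₂ * Z ^ (p - 1) := (h2 t ξ htM).trans (by gcongr)
    have b3 : |Q x t ξ| ≤ C₃ * Z ^ p := (h3 t ξ htM).trans (by gcongr)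
    rw [hPQ, add_mul]
    calc ‖inner ℝ (gradXi A x t ξ) (v.grad x) + (P x t ξ * v.val x + Q x t ξ * v.val x)‖
        ≤ |inner ℝ (gradXi A x t ξ) (v.grad x)| + (|P x t ξ * v.val x| + |Q x t ξ * v.val x|) :=
          (abs_add_le _ _).trans (by gcongr; exact abs_add_le _ _)
      _ ≤ C₁ * Z ^ (p - 1) * Z + (C₂ * Z ^ (p - 1) * Z + C₃ * Z ^ p * v.normInfty) := by
          rw [abs_mul, abs_mul]
          refine add_le_add ((abs_real_inner_le_norm _ _).trans ?_) (add_le_add ?_ ?_) <;> gcongr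
      _ = (C₁ + C₂ + C₃ * v.normInfty) * Z ^ p := by
          rw [mul_assoc, mul_assoc, hpow]; ring
  · filter_upwards [hA.2] with x hx s _ using hasDerivAt_along_line hx _ _ _ _ s

/-- Pairing a Nemytskii operator with a continuous linear map into a conjugate Lebesgue space
gives a dual-valued map. -/
theorem IsNemytskii.exists_pairing {H F : Type*} [NormedAddCommGroup H] [NormedSpace ℝ H]
    [NormedAddCommGroup F] [NormedSpace ℝ F] {s : ℝ}
    {B : Eucl N → ℝ → Eucl N → H} (h : IsNemytskii s Ω B) {r q : ℝ≥0∞} [Fact (1 ≤ r)]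
    [Fact (1 ≤ q)] [ENNReal.HolderConjugate r q]
    (hs : 0 < s) (hr' : r ≠ ⊤) (hr : r * ENNReal.ofReal s = ENNReal.ofReal p)
    (L : H →L[ℝ] F →L[ℝ] ℝ) (T : SobolevX p Ω →L[ℝ] Lp F q (volume.restrict Ω))
    (τ : SobolevX p Ω → Eucl N → F) (hT : ∀ v, T v =ᵐ[volume.restrict Ω] τ v) :
    (∀ u v : SobolevX p Ω, Integrable (fun x => L (B x (u.val x) (u.grad x)) (τ v x)) (volume.restrict Ω)) ∧
    ∃ D : SobolevX p Ω → StrongDual ℝ (SobolevX p Ω),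
      (∀ u v : SobolevX p Ω, D u v = ∫ x in Ω, L (B x (u.val x) (u.grad x)) (τ v x)) ∧
      ∀ (un : ℕ → SobolevX p Ω) (u : SobolevX p Ω) (M : ℝ),
        Tendsto (fun n => (un n - u).normW) atTop (𝓝 0) →
        (∀ n, (un n).normInfty ≤ M) →
        (∀ᵐ x ∂volume.restrict Ω, Tendsto (fun n => (un n).val x) atTop (𝓝 (u.val x))) →
        Tendsto (fun n => D (un n)) atTop (𝓝 (D u)) := by
  -- The dual-valued map is the Nemytskii operator into `Lʳ`, followed by the continuous linear
  -- Hölder pairing and the pullback along `T`; only the first factor is nonlinear.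
  refine ⟨fun u v => (h.memLp hs hr u).integrable_bilin L ((Lp.memLp (T v)).ae_eq (hT v)),
    fun u => (L.lpPairing (volume.restrict Ω) r q (h.toLp hs hr u)).comp T,
    fun u v => lpPairing_toLp L (h.memLp hs hr u) (T v) (hT v), fun un u M hW hM hae => ?_⟩
  exact (h.tendsto_toLp hs hr' hr hW hM hae).clm_comp_right _ T

set_option maxHeartbeats 1000000 in
/-- The functional `u ↦ ∫_Ω A(x, u, ∇u)` is `C¹` on `X`, with sequential continuity of its values
and of its differential under convergence in `W`, boundedness in `L^∞` and convergence a.e. -/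
theorem exists_differential
    (hA : IsCaratheodory 1 Ω (fun x (y : ℝ × Eucl N) => A x y.1 y.2)) (hG : GrowthA p Ω A) :
    (∀ u : SobolevX p Ω, IntegrableOn (fun x => A x (u.val x) (u.grad x)) Ω) ∧
    (∀ u v : SobolevX p Ω,
      IntegrableOn (fun x => inner ℝ (gradXi A x (u.val x) (u.grad x)) (v.grad x)) Ω ∧
      IntegrableOn (fun x => partialT A x (u.val x) (u.grad x) * v.val x) Ω) ∧
    ∃ dA : SobolevX p Ω → StrongDual ℝ (SobolevX p Ω),
      (∀ u v : SobolevX p Ω, dA u v =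
        (∫ x in Ω, inner ℝ (gradXi A x (u.val x) (u.grad x)) (v.grad x)) +
          ∫ x in Ω, partialT A x (u.val x) (u.grad x) * v.val x) ∧
      (∀ (un : ℕ → SobolevX p Ω) (u : SobolevX p Ω) (M : ℝ),
        Tendsto (fun n => (un n - u).normW) atTop (𝓝 0) →
        (∀ n, (un n).normInfty ≤ M) →
        (∀ᵐ x ∂volume.restrict Ω, Tendsto (fun n => (un n).val x) atTop (𝓝 (u.val x))) →
        Tendsto (fun n => ∫ x in Ω, A x ((un n).val x) ((un n).grad x)) atTop
          (𝓝 (∫ x in Ω, A x (u.val x) (u.grad x))) ∧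
        Tendsto (fun n => dA (un n)) atTop (𝓝 (dA u))) ∧
      ∀ u : SobolevX p Ω, HasFDerivAt
        (fun u : SobolevX p Ω => ∫ x in Ω, A x (u.val x) (u.grad x)) (dA u) u := by
  have hp1 : 1 < p := hp.out
  have hp0 : 0 < p := by linarith
  have hs : 0 < p - 1 := by linarith
  have hNA := isNemytskii_of_growthA hA hp1 hG
  have hNa := isNemytskii_gradXi hA hp1 hG
  obtain ⟨P, Q, hP, hQ, hPQ⟩ := exists_partialT_split hA hp1 hG
  -- The exponent `p / (p - 1)` is both conjugate to `p` and the target exponent for order `p - 1`.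
  -- The part of order `p` uses the conjugate pair `1`, `∞` instead.
  have : ENNReal.HolderConjugate (ENNReal.ofReal (p / (p - 1))) (ENNReal.ofReal p) :=
    (Real.HolderConjugate.conjExponent hp1).symm.ennrealOfReal
  have hr : ENNReal.ofReal (p / (p - 1)) * ENNReal.ofReal (p - 1) = ENNReal.ofReal p := by
    rw [← ENNReal.ofReal_mul (by positivity), div_mul_cancel₀ _ hs.ne']
  have : Fact (1 ≤ ENNReal.ofReal (p / (p - 1))) := ⟨by
    rw [ENNReal.one_le_ofReal, one_le_div hs]; linarith⟩
  obtain ⟨i1, D₁, d1, c1⟩ := hNa.exists_pairing hs ENNReal.ofReal_ne_top hr (innerSL ℝ)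
    SobolevX.gradL SobolevX.grad fun _ => EventuallyEq.rfl
  obtain ⟨i2, D₂, d2, c2⟩ := hP.exists_pairing hs ENNReal.ofReal_ne_top hr
    (ContinuousLinearMap.mul ℝ ℝ) SobolevX.valL SobolevX.val fun _ => EventuallyEq.rfl
  obtain ⟨i3, D₃, d3, c3⟩ := hQ.exists_pairing hp0 ENNReal.one_ne_top (one_mul _)
    (ContinuousLinearMap.mul ℝ ℝ) SobolevX.inftyL SobolevX.val SobolevX.coe_inftyL
  replace d1 : ∀ u v : SobolevX p Ω, D₁ u v =
      ∫ x in Ω, inner ℝ (gradXi A x (u.val x) (u.grad x)) (v.grad x) := d1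
  replace i1 : ∀ u v : SobolevX p Ω, Integrable
      (fun x => inner ℝ (gradXi A x (u.val x) (u.grad x)) (v.grad x)) (volume.restrict Ω) := i1
  simp only [ContinuousLinearMap.mul_apply'] at i2 d2 i3 d3
  have hintT : ∀ u v : SobolevX p Ω,
      Integrable (fun x => partialT A x (u.val x) (u.grad x) * v.val x) (volume.restrict Ω) := by
    intro u v
    simp only [hPQ, add_mul]
    exact (i2 u v).add (i3 u v)
  refine ⟨fun u => memLp_one_iff_integrable.1 (hNA.memLp hp0 (one_mul _) u),
    fun u v => ⟨i1 u v, hintT u v⟩, ?_⟩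
  have hdA : ∀ u v : SobolevX p Ω, (D₁ u + (D₂ u + D₃ u)) v =
      (∫ x in Ω, inner ℝ (gradXi A x (u.val x) (u.grad x)) (v.grad x)) +
        ∫ x in Ω, partialT A x (u.val x) (u.grad x) * v.val x := by
    intro u v
    rw [add_apply, add_apply, d1, d2, d3, ← integral_add (i2 u v) (i3 u v)]
    simp only [hPQ, add_mul]
  have hconv : ∀ (un : ℕ → SobolevX p Ω) (u : SobolevX p Ω) (M : ℝ),
      Tendsto (fun n => (un n - u).normW) atTop (𝓝 0) → (∀ n, (un n).normInfty ≤ M) →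
      (∀ᵐ x ∂volume.restrict Ω, Tendsto (fun n => (un n).val x) atTop (𝓝 (u.val x))) →
      Tendsto (fun n => D₁ (un n) + (D₂ (un n) + D₃ (un n))) atTop (𝓝 (D₁ u + (D₂ u + D₃ u))) :=
    fun un u M hW hM hae => (c1 un u M hW hM hae).add
      ((c2 un u M hW hM hae).add (c3 un u M hW hM hae))
  refine ⟨fun u => D₁ u + (D₂ u + D₃ u), hdA,
    fun un u M hW hM hae => ⟨?_, hconv un u M hW hM hae⟩, ?_⟩
  · exact tendsto_integral_of_L1' _ (hNA.memLp hp0 (one_mul _) u).1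
      (Eventually.of_forall fun n => memLp_one_iff_integrable.1 (hNA.memLp hp0 (one_mul _) (un n)))
      (hNA.tendsto_eLpNorm hp0 le_rfl ENNReal.one_ne_top (one_mul _) hW hM hae)
  · refine hasFDerivAt_of_hasDerivAt_line (fun u v => ?_) (SobolevX.continuous_of_seq hconv)
    rw [hdA, ← integral_add (i1 u v) (hintT u v)]
    exact hasDerivAt_integral_line hA hG u v

end Functional

/-! ### The primitive `G` as an integrand independent of `ξ`. -/

section Primitive

variable {N : ℕ} {Ω : Set (Eucl N)} {g : Eucl N → ℝ → ℝ} {p : ℝ}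

theorem hasDerivAt_primitiveG {x : Eucl N} (hx : Continuous (g x)) (t : ℝ) :
    HasDerivAt (primitiveG g x) (g x t) t :=
  intervalIntegral.integral_hasDerivAt_right (hx.intervalIntegrable _ _)
    (hx.stronglyMeasurableAtFilter _ _) hx.continuousAt

theorem contDiff_primitiveG {x : Eucl N} (hx : Continuous (g x)) :
    ContDiff ℝ 1 (primitiveG g x) := by
  rw [contDiff_one_iff_deriv]
  refine ⟨fun t => (hasDerivAt_primitiveG hx t).differentiableAt, ?_⟩
  rw [show deriv (primitiveG g x) = g x from funext fun t => (hasDerivAt_primitiveG hx t).deriv]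
  exact hx

theorem aemeasurable_primitiveG (hg : IsCaratheodory 0 Ω g) (t : ℝ) :
    AEMeasurable (fun x => primitiveG g x t) (volume.restrict Ω) := by
  have key : ∀ S : Set ℝ, AEStronglyMeasurable (fun x => ∫ τ in S, g x τ)
      (volume.restrict Ω) := by
    intro S
    have hm : AEStronglyMeasurable (fun z : Eucl N × ℝ => g z.1 z.2)
        ((volume.restrict Ω).prod (volume.restrict S)) := by
      -- Joint measurability of `g`: on the product space, `g z.1` is a Carathéodory map superposed
      -- with the second projection. Integrating out `τ` then leaves a measurable function of `x`.
      refine aestronglyMeasurable_superposition (B := fun (z : Eucl N × ℝ) τ => g z.1 τ)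
        (fun τ => (hg.1 τ).aestronglyMeasurable.comp_fst) ?_ measurable_snd.aestronglyMeasurable
      have : ∀ᵐ x ∂volume.restrict Ω, Continuous (g x) := by
        filter_upwards [hg.2] with x hx using hx.continuous
      exact Measure.quasiMeasurePreserving_fst.ae this
    exact hm.integral_prod_right'
  simp only [primitiveG, intervalIntegral]
  exact ((key _).sub (key _)).aemeasurable

theorem isCaratheodory_primitiveG (hg : IsCaratheodory 0 Ω g) :
    IsCaratheodory 1 Ω (fun x (y : ℝ × Eucl N) => primitiveG g x y.1) := by
  refine ⟨fun y => aemeasurable_primitiveG hg y.1, ?_⟩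
  filter_upwards [hg.2] with x hx
  exact (contDiff_primitiveG hx.continuous).comp contDiff_fst

theorem gradXi_primitiveG (x : Eucl N) (t : ℝ) (ξ : Eucl N) :
    gradXi (fun x t _ => primitiveG g x t) x t ξ = 0 := by
  simp [gradXi, gradient]

theorem partialT_primitiveG {x : Eucl N} (hx : Continuous (g x)) (t : ℝ) (ξ : Eucl N) :
    partialT (fun x t _ => primitiveG g x t) x t ξ = g x t :=
  (hasDerivAt_primitiveG hx t).deriv

/-- Factoring out `|t| ^ (p - 1)` leaves the coefficient `a₁ + a₂ |t| ^ (q - p)`, continuous because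
`q ≥ p`. It is nondecreasing in `|t|`, so its value at `t` bounds the integrand on the whole
interval between `0` and `t`. -/
theorem growthA_primitiveG (hp : 1 < p) (hg : IsCaratheodory 0 Ω g) (hG : GrowthG p Ω g) :
    GrowthA p Ω (fun x t _ => primitiveG g x t) := by
  obtain ⟨a₁, a₂, q, h1, h2, hq, h⟩ := hG
  have hp1 : 0 ≤ p - 1 := by linarith
  have hqp : 0 ≤ q - p := by linarith
  set Ψ : ℝ → ℝ := fun t => a₁ + a₂ * |t| ^ (q - p) with hΨ
  have hΨc : Continuous Ψ :=
    continuous_const.add (continuous_const.mul (continuous_abs.rpow_const fun _ => Or.inr hqp))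
  have hΨp : ∀ t, 0 < Ψ t := fun t => by simp only [hΨ]; positivity
  have hg1 : ∀ᵐ x ∂volume.restrict Ω, ∀ t, |g x t| ≤ Ψ t * |t| ^ (p - 1) := by
    filter_upwards [h] with x hx t
    refine (hx t).trans (le_of_eq ?_)
    simp only [hΨ]
    rw [add_mul, mul_assoc, ← Real.rpow_add' (abs_nonneg t) (by linarith)]
    congr 3; ring
  have hG1 : ∀ᵐ x ∂volume.restrict Ω, ∀ t, |primitiveG g x t| ≤ Ψ t * |t| ^ p := by
    filter_upwards [hg1] with x hx t
    have hb : ∀ τ ∈ Set.uIoc 0 t, ‖g x τ‖ ≤ Ψ t * |t| ^ (p - 1) := by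
      intro τ hτ
      have hτt : |τ| ≤ |t| := by
        have := Set.abs_sub_left_of_mem_uIcc (Set.uIoc_subset_uIcc hτ)
        simpa using this
      refine (hx τ).trans ?_
      simp only [hΨ]
      gcongr
    have := intervalIntegral.norm_integral_le_of_norm_le_const hb
    refine this.trans (le_of_eq ?_)
    rw [sub_zero, mul_assoc]
    congr 1
    conv_lhs => rw [← Real.rpow_one |t|, ← Real.rpow_mul (abs_nonneg t), one_mul]
    rw [← Real.rpow_add' (abs_nonneg t) (by linarith), sub_add_cancel]
  -- The value `1` is arbitrary: the `ξ`-terms are not needed, but their coefficients must be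
  -- positive.
  refine ⟨fun _ => Ψ, fun _ _ => 1, fun _ => ⟨hΨc, continuous_const⟩,
    fun _ t => ⟨hΨp t, one_pos⟩, ?_, ?_, ?_⟩
  · filter_upwards [hG1] with x hx t ξ
    exact (hx t).trans (le_add_of_nonneg_right (by positivity))
  · filter_upwards [hg1, hg.2] with x hx hx' t ξ
    rw [partialT_primitiveG hx'.continuous]
    exact (hx t).trans (le_add_of_nonneg_right (by positivity))
  · refine Eventually.of_forall fun x t ξ => ?_
    rw [gradXi_primitiveG, norm_zero]
    have := (hΨp t).le
    positivity

end Primitive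

end

theorem proposition2p6 {N : ℕ} (Ω : Set (Eucl N)) (hΩ : IsOpen Ω) (p : ℝ) [Fact (1 < p)]
    (A : Eucl N → ℝ → Eucl N → ℝ) (g : Eucl N → ℝ → ℝ)
    (hH0 : IsCaratheodory 1 Ω (fun x (y : ℝ × Eucl N) => A x y.1 y.2))
    (hH1 : GrowthA p Ω A)
    (hG0 : IsCaratheodory 0 Ω g)
    (hG1 : GrowthG p Ω g) :
    -- all the integrals that define `J(u)` and `⟨dJ(u), v⟩` converge
    (∀ u : SobolevX p Ω,
      IntegrableOn (fun x => A x (u.val x) (u.grad x)) Ω ∧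
      IntegrableOn (fun x => primitiveG g x (u.val x)) Ω) ∧
    (∀ u v : SobolevX p Ω,
      IntegrableOn (fun x => inner ℝ (gradXi A x (u.val x) (u.grad x)) (v.grad x)) Ω ∧
      IntegrableOn (fun x => partialT A x (u.val x) (u.grad x) * v.val x) Ω ∧
      IntegrableOn (fun x => g x (u.val x) * v.val x) Ω) ∧
    -- `dJ(u)` is an element of the dual space `X'`
    ∃ dJ : SobolevX p Ω → StrongDual ℝ (SobolevX p Ω),
      (∀ u v : SobolevX p Ω, dJ u v = diffJ A g u v) ∧
      (∀ (un : ℕ → SobolevX p Ω) (u : SobolevX p Ω) (M : ℝ), 0 < M →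
        Tendsto (fun n => (un n - u).normW) atTop (𝓝 0) →
        (∀ n, (un n).normInfty ≤ M) →
        (∀ᵐ x ∂volume.restrict Ω, Tendsto (fun n => (un n).val x) atTop (𝓝 (u.val x))) →
        Tendsto (fun n => energyJ A g (un n)) atTop (𝓝 (energyJ A g u)) ∧
        Tendsto (fun n => ‖dJ (un n) - dJ u‖) atTop (𝓝 0)) ∧
      ContDiff ℝ 1 (energyJ A g : SobolevX p Ω → ℝ) ∧
      (∀ u : SobolevX p Ω, HasFDerivAt (energyJ A g) (dJ u) u) := by
  have hp : 1 < p := Fact.out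
  obtain ⟨iA, jA, dA, hdA, cA, fA⟩ := exists_differential hH0 hH1
  obtain ⟨iG, jG, dG, hdG, cG, fG⟩ := exists_differential
    (A := fun x t _ => primitiveG g x t) (p := p)
    (isCaratheodory_primitiveG hG0) (growthA_primitiveG hp hG0 hG1)
  have hT : ∀ u v : SobolevX p Ω,
      (fun x => partialT (fun x t _ => primitiveG g x t) x (u.val x) (u.grad x) * v.val x)
        =ᵐ[volume.restrict Ω] fun x => g x (u.val x) * v.val x := by
    intro u v
    filter_upwards [hG0.2] with x hx
    rw [partialT_primitiveG hx.continuous]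
  have hconv : ∀ (un : ℕ → SobolevX p Ω) (u : SobolevX p Ω) (M : ℝ),
      Tendsto (fun n => (un n - u).normW) atTop (𝓝 0) → (∀ n, (un n).normInfty ≤ M) →
      (∀ᵐ x ∂volume.restrict Ω, Tendsto (fun n => (un n).val x) atTop (𝓝 (u.val x))) →
      Tendsto (fun n => dA (un n) - dG (un n)) atTop (𝓝 (dA u - dG u)) :=
    fun un u M hW hM hae => (cA un u M hW hM hae).2.strongDual_sub (cG un u M hW hM hae).2
  have hF : ∀ u : SobolevX p Ω, HasFDerivAt (energyJ A g) (dA u - dG u) u :=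
    fun u => (fA u).sub (fG u)
  refine ⟨fun u => ⟨iA u, iG u⟩,
    fun u v => ⟨(jA u v).1, (jA u v).2, (jG u v).2.congr (hT u v)⟩,
    fun u => dA u - dG u, fun u v => ?_, fun un u M _ hW hM hae => ⟨?_, ?_⟩, ?_, hF⟩
  · have e1 : (dA u - dG u) v = dA u v - dG u v := rfl
    have e2 : dG u v = ∫ x in Ω, g x (u.val x) * v.val x := by
      rw [hdG u v, integral_congr_ae (hT u v)]
      simp only [gradXi_primitiveG, inner_zero_left, integral_zero, zero_add]
    exact e1.trans (congrArg₂ (· - ·) (hdA u v) e2)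
  · exact (cA un u M hW hM hae).1.sub (cG un u M hW hM hae).1
  · exact (hconv un u M hW hM hae).norm_strongDual_sub
  · exact contDiff_one_of_hasFDerivAt (SobolevX.continuous_of_seq hconv) hF
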